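/- Let $\mathbb F_q$ be a finite field (with the discrete topology) and give $V=\mathbb F_q^{\mathbb N}$ the product topology. Let $\mathrm{Sub}_{\mathbb F_q}(V)$ be the space of closed linear subspaces of $V$ with the Chabauty topology (generated by the sets of subspaces disjoint from a given compact set and the sets of subspaces meeting a given open set) and its Borel $\sigma$-algebra, and let $\mathrm{Aut}_{\mathbb F_q}(V)$ be the group of all linear homeomorphisms $V\to V$. Let $\mathrm{CRS}_{\mathbb F_q}(V)$ be the convex set of Borel probability measures on $\mathrm{Sub}_{\mathbb F_q}(V)$ that are invariant under $\mathrm{Aut}_{\mathbb F_q}(V)$, and let $\mathrm{CRS}^e_{\mathbb F_q}(V)$ be the set of its indecomposable elements, i.e. of those $\lambda\in\mathrm{CRS}_{\mathbb F_q}(V)$ that cannot be written as $\lambda=t\mu_1+(1-t)\mu_2$ with $0<t<1$ and $\mu_1\neq\mu_2$ in $\mathrm{CRS}_{\mathbb F_q}(V)$. Theorem. Let $\lambda\in\mathrm{CRS}^e_{\mathbb F_q}(\mathbb F_q^{\mathbb N})$ with $\lambda\neq\delta_{\mathbb F_q^{\mathbb N}}$. Then there is a unique integer $\kappa\ge 0$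 such that the random subspace $h(\mathbb F_q^{\kappa})$ has law $\lambda$, where $h$ is a random element of the compact group $\mathrm{Hom}_{\mathbb F_q}(\mathbb F_q^{\kappa},\mathbb F_q^{\mathbb N})$ of (continuous) linear maps, with the compact-open topology, distributed according to its Haar probability measure. -/

import Mathlib

open MeasureTheory TopologicalSpace
open scoped NNReal

/-! ### The space of closed subspaces -/

section Sub

variable {F V : Type*} [Field F] [AddCommGroup V] [Module F V] [TopologicalSpace V]

/-- The Chabauty (Fell) topology on the set of closed subspaces of `V`: it is generated by the sets
of closed subspaces missing a given compact set and the sets of closed subspaces meeting a given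
open set. -/
instance ClosedSubmodule.chabauty : TopologicalSpace (ClosedSubmodule F V) :=
  .generateFrom
    ({A | ∃ K : Set V, IsCompact K ∧ A = {H : ClosedSubmodule F V | Disjoint (H : Set V) K}} ∪
      {A | ∃ U : Set V, IsOpen U ∧ A = {H : ClosedSubmodule F V | ((H : Set V) ∩ U).Nonempty}})

instance ClosedSubmodule.borelMeasurableSpace : MeasurableSpace (ClosedSubmodule F V) :=
  borel (ClosedSubmodule F V)

instance ClosedSubmodule.borelSpace : BorelSpace (ClosedSubmodule F V) := ⟨rfl⟩

theorem ClosedSubmodule.continuous_mapEquiv (φ : V ≃L[F] V) :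
    Continuous (ClosedSubmodule.mapEquiv φ : ClosedSubmodule F V → ClosedSubmodule F V) := by
  refine continuous_generateFrom_iff.2 ?_
  rintro _ (⟨K, hK, rfl⟩ | ⟨U, hU, rfl⟩)
  · refine isOpen_generateFrom_of_mem (Or.inl ⟨φ.symm '' K, hK.image φ.symm.continuous, ?_⟩)
    ext H
    simp only [Set.mem_preimage, Set.mem_ofPred_eq, Set.disjoint_left]
    constructor
    · rintro h x hx ⟨y, hy, rfl⟩
      exact h (a := y) ((ClosedSubmodule.mem_mapEquiv_iff φ _ y).2 hx) hy
    · intro h y hy hyK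
      exact h ((ClosedSubmodule.mem_mapEquiv_iff φ _ y).1 hy) ⟨y, hyK, rfl⟩
  · refine isOpen_generateFrom_of_mem (Or.inr ⟨φ ⁻¹' U, hU.preimage φ.continuous, ?_⟩)
    ext H
    simp only [Set.mem_preimage, Set.mem_ofPred_eq]
    constructor
    · rintro ⟨y, hy, hyU⟩
      exact ⟨φ.symm y, (ClosedSubmodule.mem_mapEquiv_iff φ _ y).1 hy, by simpa using hyU⟩
    · rintro ⟨x, hx, hxU⟩
      exact ⟨φ x, (ClosedSubmodule.mem_mapEquiv_iff φ _ (φ x)).2 (by simpa using hx), hxU⟩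

/-- The action of `Aut_F(V)` on closed subspaces is by Borel maps. -/
theorem ClosedSubmodule.measurable_mapEquiv (φ : V ≃L[F] V) :
    Measurable (ClosedSubmodule.mapEquiv φ : ClosedSubmodule F V → ClosedSubmodule F V) :=
  (ClosedSubmodule.continuous_mapEquiv φ).measurable

variable (F V)

/-- `CRS_F(V)`: the laws of `Aut_F(V)`-invariant random closed subspaces of `V`, that is, the Borel
probability measures on the space of closed subspaces of `V` that are invariant under all
homeomorphic linear automorphisms of `V`. -/
def CRS : Set (Measure (ClosedSubmodule F V)) :=
  {μ | IsProbabilityMeasure μ ∧ ∀ φ : V ≃L[F] V, μ.map (ClosedSubmodule.mapEquiv φ) = μ}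

/-- `CRS^e_F(V)`: the indecomposable elements (extreme points) of `CRS_F(V)`, those that are not of
the form `t μ₁ + (1 - t) μ₂` with `0 < t < 1` and `μ₁ ≠ μ₂` in `CRS_F(V)`. -/
def indecomposableCRS : Set (Measure (ClosedSubmodule F V)) :=
  {μ | μ ∈ CRS F V ∧ ¬ ∃ μ₁ ∈ CRS F V, ∃ μ₂ ∈ CRS F V, ∃ t : ℝ≥0,
    μ₁ ≠ μ₂ ∧ 0 < t ∧ t < 1 ∧ μ = t • μ₁ + (1 - t) • μ₂}

end Sub

/-! ### The compact group of continuous linear maps -/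

section Hom

variable {F V W : Type*} [Field F] [AddCommGroup V] [Module F V] [TopologicalSpace V]
  [AddCommGroup W] [Module F W] [TopologicalSpace W]

/-- The compact-open topology on `Hom_F(V, W)`. -/
instance linHomCompactOpen : TopologicalSpace (V →L[F] W) :=
  .induced (fun h => (h : C(V, W))) ContinuousMap.compactOpen

instance linHomMeasurableSpace : MeasurableSpace (V →L[F] W) := borel (V →L[F] W)

instance linHomBorelSpace : BorelSpace (V →L[F] W) := ⟨rfl⟩

theorem linHom_continuous_eval (x : V) : Continuous fun h : V →L[F] W => h x :=
  (continuous_eval_const (F := C(V, W)) x).comp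
    (continuous_induced_dom (f := fun h : V →L[F] W => (h : C(V, W))))

instance linHomTopologicalAddGroup [IsTopologicalAddGroup W] :
    IsTopologicalAddGroup (V →L[F] W) :=
  topologicalAddGroup_induced
    ({ toFun := fun h => (h : C(V, W))
       map_zero' := rfl
       map_add' := fun _ _ => rfl } : (V →L[F] W) →+ C(V, W))

instance linHomCompactSpace [DiscreteTopology V] [IsTopologicalAddGroup W]
    [ContinuousConstSMul F W] [CompactSpace W] [T2Space W] : CompactSpace (V →L[F] W) := by
  have hind : Topology.IsInducing fun h : V →L[F] W => (h : C(V, W)) := ⟨rfl⟩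
  have hemb : Topology.IsInducing fun (h : V →L[F] W) (x : V) => h x :=
    ContinuousMap.homeoFnOfDiscrete.isInducing.comp hind
  have hrange : Set.range (fun (h : V →L[F] W) (x : V) => h x) =
      {f : V → W | (∀ x y, f (x + y) = f x + f y) ∧ ∀ (c : F) x, f (c • x) = c • f x} := by
    ext f
    constructor
    · rintro ⟨h, rfl⟩
      exact ⟨fun x y => map_add h x y, fun c x => map_smul h c x⟩
    · rintro ⟨h1, h2⟩
      exact ⟨⟨⟨⟨f, h1⟩, h2⟩, continuous_of_discreteTopology⟩, rfl⟩
  have hclosed : IsClosed (Set.range (fun (h : V →L[F] W) (x : V) => h x)) := by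
    rw [hrange, Set.ofPred_and]
    simp only [Set.ofPred_forall]
    refine IsClosed.inter ?_ ?_
    · exact isClosed_iInter fun x => isClosed_iInter fun y =>
        isClosed_eq (by fun_prop) (by fun_prop)
    · exact isClosed_iInter fun c => isClosed_iInter fun x =>
        isClosed_eq (by fun_prop) (by fun_prop)
  exact ⟨(hemb.isCompact_iff).2 (by simpa [Set.image_univ] using hclosed.isCompact)⟩

/-- The Haar probability measure of a compact group, written additively. -/
noncomputable def haarProb (G : Type*) [AddGroup G] [TopologicalSpace G] [IsTopologicalAddGroup G]
    [CompactSpace G] [MeasurableSpace G] [BorelSpace G] : Measure G :=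
  Measure.addHaarMeasure (⊤ : PositiveCompacts G)

/-- The image `h(V)` of a finite space `V` under a linear map, as a closed subspace. -/
def imageSubspace [Finite V] [T1Space W] (h : V →L[F] W) : ClosedSubmodule F W where
  toSubmodule := LinearMap.range (h : V →ₗ[F] W)
  isClosed' := (Set.finite_range h).isClosed

/-- The map sending `h` to its image is Borel. -/
theorem measurable_imageSubspace [Finite V] [T2Space W] :
    Measurable (imageSubspace : (V →L[F] W) → ClosedSubmodule F W) := by
  have hmem : ∀ (h : V →L[F] W) (y : W), y ∈ (imageSubspace h : Set W) ↔ ∃ x, h x = y :=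
    fun _ _ => Iff.rfl
  refine Continuous.measurable (continuous_generateFrom_iff.2 ?_)
  rintro _ (⟨K, hK, rfl⟩ | ⟨U, hU, rfl⟩)
  · have : (imageSubspace : (V →L[F] W) → _) ⁻¹'
        {H : ClosedSubmodule F W | Disjoint (H : Set W) K} = ⋂ x : V, {h | h x ∈ Kᶜ} := by
      ext h
      simp only [Set.mem_preimage, Set.mem_ofPred_eq, Set.disjoint_left, hmem, Set.mem_iInter]
      exact ⟨fun H x => H ⟨x, rfl⟩, by rintro H _ ⟨x, rfl⟩; exact H x⟩
    rw [this]
    exact isOpen_iInter_of_finite fun x =>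
      hK.isClosed.isOpen_compl.preimage (linHom_continuous_eval x)
  · have : (imageSubspace : (V →L[F] W) → _) ⁻¹'
        {H : ClosedSubmodule F W | ((H : Set W) ∩ U).Nonempty} = ⋃ x : V, {h | h x ∈ U} := by
      ext h
      simp only [Set.mem_preimage, Set.mem_ofPred_eq, Set.Nonempty, Set.mem_inter_iff, hmem,
        Set.mem_iUnion]
      exact ⟨by rintro ⟨_, ⟨x, rfl⟩, hx⟩; exact ⟨x, hx⟩, by rintro ⟨x, hx⟩; exact ⟨_, ⟨x, rfl⟩, hx⟩⟩
    rw [this]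
    exact isOpen_iUnion fun x => hU.preimage (linHom_continuous_eval x)

end Hom

open Filter Topology

/-! ### Duality between closed subspaces and annihilators -/

section Dual

/-! Pass to the dual. The continuous dual of `F^ℕ` is the countable space spanned by the
coordinates, and a closed subspace is recovered from its annihilator. Hence the law of a random
closed subspace is determined by the probabilities that `m` independent functionals all annihilate
it (`measure_ext_of_annihilator`).

The index of the annihilator is invariant under automorphisms, so indecomposability makes it almost
surely a constant `k`, with `0` coding infinite index. Given the event `E` that `m` independent
functionals annihilate, invariance under transvections gives a further functional `g` the same
probability of annihilating jointly with `E`, apart from finitely many `g`. Averaging over the first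
`|F|^n` functionals, this joint probability is the limit of the integral over `E` of the density of
the annihilator, and that density tends to `1/k`. By induction the probabilities are `k⁻¹ ^ m`
(`CRS.measureReal_forall_mem_annihilator`).

If `k = 0` these are the probabilities of the Dirac mass at the whole space. Otherwise the quotient
by the annihilator is a finite vector space, so `k = |F|^κ`, and the image of a Haar random map from
`F^κ` has the same probabilities, computed as inverse indices of kernels
(`haarProb_map_imageSubspace`). -/

theorem exists_cylinder_subset {X : Type*} [TopologicalSpace X] {U : Set (ℕ → X)} (hU : IsOpen U)
    {x : ℕ → X} (hx : x ∈ U) : ∃ n : ℕ, ∀ y : ℕ → X, (∀ i < n, y i = x i) → y ∈ U := by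
  obtain ⟨I, u, hu, hIU⟩ := isOpen_pi_iff.1 hU x hx
  refine ⟨I.sup id + 1, fun y hy => hIU fun i hi => ?_⟩
  rw [hy i (Nat.lt_succ_of_le (Finset.le_sup (f := id) hi))]
  exact (hu i hi).2

theorem exists_linearIndependent_span_eq {K V : Type*} [Field K] [AddCommGroup V] [Module K V]
    (s : Finset V) : ∃ (m : ℕ) (b : Fin m → V), LinearIndependent K b ∧
      Submodule.span K (Set.range b) = Submodule.span K (s : Set V) := by
  have : FiniteDimensional K (Submodule.span K (s : Set V)) := FiniteDimensional.span_finset K s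
  let b := Module.finBasis K (Submodule.span K (s : Set V))
  refine ⟨_, fun i => (b i : V), b.linearIndependent.map' _ (Submodule.ker_subtype _), ?_⟩
  have h := congrArg (Submodule.map (Submodule.subtype _)) b.span_eq
  rwa [Submodule.map_span, Submodule.map_top, Submodule.range_subtype, ← Set.range_comp] at h

variable {F : Type*} [Field F] [TopologicalSpace F] [DiscreteTopology F]

variable (F) in
/-- The span of the first `n` coordinate functionals on `F^ℕ`. -/
def coordSpan (n : ℕ) : Submodule F ((ℕ → F) →L[F] F) :=
  LinearMap.range
    (Fintype.linearCombination F fun i : Fin n => (ContinuousLinearMap.proj (i : ℕ) : (ℕ → F) →L[F] F))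

theorem mem_coordSpan {n : ℕ} {f : (ℕ → F) →L[F] F} :
    f ∈ coordSpan F n ↔ ∃ a : Fin n → F, ∀ x, f x = ∑ i, a i * x i := by
  simp only [coordSpan, LinearMap.mem_range, Fintype.linearCombination_apply, ContinuousLinearMap.ext_iff]
  refine exists_congr fun a => forall_congr' fun x => ?_
  simp [eq_comm]

theorem coordSpan_mono : Monotone (coordSpan F) := by
  refine monotone_nat_of_le_succ fun n f hf => ?_
  obtain ⟨a, ha⟩ := mem_coordSpan.1 hf
  refine mem_coordSpan.2 ⟨Fin.snoc a 0, fun x => ?_⟩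
  simp [ha, Fin.sum_univ_castSucc]

/-- Since `F` is discrete, the kernel is an open neighbourhood of `0`, so it contains all vectors
whose first `n` coordinates vanish. -/
theorem exists_mem_coordSpan (f : (ℕ → F) →L[F] F) : ∃ n, f ∈ coordSpan F n := by
  obtain ⟨n, hn⟩ := exists_cylinder_subset
    ((isOpen_discrete ({0} : Set F)).preimage f.continuous) (x := 0) (by simp)
  refine ⟨n, mem_coordSpan.2 ⟨fun i => f (Pi.single (i : ℕ) 1), fun x => ?_⟩⟩
  have h : f (x - ∑ i : Fin n, x i • Pi.single (i : ℕ) (1 : F)) = 0 := by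
    refine hn _ fun j hj => ?_
    have : ∀ i : Fin n, i ≠ ⟨j, hj⟩ → x i * (Pi.single (i : ℕ) (1 : F) : ℕ → F) j = 0 := by
      intro i hi
      rw [Pi.single_eq_of_ne (fun h => hi (Fin.ext h.symm)), mul_zero]
    simp [Finset.sum_apply, Fintype.sum_eq_single _ this]
  rw [map_sub, sub_eq_zero] at h
  rw [h]
  simp [mul_comm]

/-- The coordinates span the dual algebraically, so a vector can be prescribed through an arbitrary
linear form on the dual, with no continuity to check. -/
theorem exists_forall_apply_eq (l : ((ℕ → F) →L[F] F) →ₗ[F] F) : ∃ v, ∀ f, f v = l f := by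
  refine ⟨fun i => l (ContinuousLinearMap.proj i), fun f => ?_⟩
  obtain ⟨n, a, rfl⟩ := exists_mem_coordSpan f
  simp [Fintype.linearCombination_apply]

theorem finite_coordSpan [Finite F] (n : ℕ) :
    (coordSpan F n : Set ((ℕ → F) →L[F] F)).Finite := by
  rw [coordSpan, LinearMap.coe_range]
  exact Set.finite_range _

instance [Finite F] (n : ℕ) : Finite (coordSpan F n) :=
  (finite_coordSpan n).to_subtype

theorem card_coordSpan (n : ℕ) : Nat.card (coordSpan F n) = Nat.card F ^ n := by
  have hinj : Function.Injective (Fintype.linearCombination F fun i : Fin n =>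
      (ContinuousLinearMap.proj (i : ℕ) : (ℕ → F) →L[F] F)) := by
    intro a b hab
    ext j
    have h := DFunLike.congr_fun hab (Pi.single (j : ℕ) (1 : F) : ℕ → F)
    have key : ∀ c : Fin n → F, (Fintype.linearCombination F (fun i : Fin n =>
      (ContinuousLinearMap.proj (i : ℕ) : (ℕ → F) →L[F] F)) c) (Pi.single (j : ℕ) (1 : F) : ℕ → F)
        = c j := by
      intro c
      rw [Fintype.linearCombination_apply, sum_apply, Fintype.sum_eq_single j]
      · simp
      · intro i hi
        simp [Pi.single_eq_of_ne (fun h => hi (Fin.ext h))]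
    rwa [key, key] at h
  rw [coordSpan, ← Nat.card_congr (LinearEquiv.ofInjective _ hinj).toEquiv, Nat.card_fun,
    Nat.card_fin]

/-- The continuous functionals vanishing on a closed subspace of `F^ℕ`. -/
def annihilator (W : ClosedSubmodule F (ℕ → F)) : Submodule F ((ℕ → F) →L[F] F) where
  carrier := {f | ∀ x ∈ W, f x = 0}
  add_mem' := fun hf hg x hx => by simp [hf x hx, hg x hx]
  zero_mem' := fun _ _ => rfl
  smul_mem' := fun c f hf x hx => by simp [hf x hx]

theorem mem_annihilator {W : ClosedSubmodule F (ℕ → F)} {f : (ℕ → F) →L[F] F} :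
    f ∈ annihilator W ↔ ∀ x ∈ W, f x = 0 := Iff.rfl

/-- Separation takes place in the projection to the first `n` coordinates. Keeping the functional in
`coordSpan F n` leaves only finitely many candidates, which is what makes the "meets an open set"
condition open below. -/
theorem exists_mem_annihilator_apply_ne_zero {W : ClosedSubmodule F (ℕ → F)} {x : ℕ → F} {n : ℕ}
    (hx : ∀ y ∈ W, ∃ i < n, y i ≠ x i) : ∃ f ∈ coordSpan F n, f ∈ annihilator W ∧ f x ≠ 0 := by
  let p : (ℕ → F) →ₗ[F] (Fin n → F) := LinearMap.funLeft F F (fun i : Fin n => (i : ℕ))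
  have hp : p x ∉ W.toSubmodule.map p := by
    rintro ⟨y, hy, hyx⟩
    obtain ⟨i, hi, hne⟩ := hx y hy
    exact hne (congr_fun hyx ⟨i, hi⟩)
  obtain ⟨l, hl, hle⟩ := Submodule.exists_le_ker_of_notMem hp
  let f : (ℕ → F) →L[F] F := Fintype.linearCombination F (fun i : Fin n =>
    (ContinuousLinearMap.proj (i : ℕ) : (ℕ → F) →L[F] F)) fun i => l (Pi.single i 1)
  have hf : ∀ y, f y = l (p y) := by
    intro y
    conv_rhs => rw [← Finset.univ_sum_single (p y), map_sum]
    simp only [f, Fintype.linearCombination_apply, sum_apply]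
    refine Finset.sum_congr rfl fun i _ => ?_
    have : (Pi.single i (p y i) : Fin n → F) = p y i • Pi.single i 1 := by
      rw [← Pi.single_smul]; simp
    rw [this, map_smul]
    simp [p, LinearMap.funLeft_apply, mul_comm]
  refine ⟨f, ⟨_, rfl⟩, fun y hy => ?_, by rwa [hf]⟩
  rw [hf]
  exact hle ⟨y, hy, rfl⟩

theorem exists_mem_annihilator_of_notMem {W : ClosedSubmodule F (ℕ → F)} {x : ℕ → F}
    (hx : x ∉ W) : ∃ f ∈ annihilator W, f x ≠ 0 := by
  obtain ⟨n, hn⟩ := exists_cylinder_subset (W.isClosed'.isOpen_compl) (x := x) hx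
  obtain ⟨f, -, hf, hfx⟩ := exists_mem_annihilator_apply_ne_zero (W := W) (x := x) (n := n) (by
    intro y hy
    by_contra! h
    exact hn y h hy)
  exact ⟨f, hf, hfx⟩

theorem annihilator_mapEquiv_mem (φ : (ℕ → F) ≃L[F] (ℕ → F)) (W : ClosedSubmodule F (ℕ → F))
    (f : (ℕ → F) →L[F] F) :
    f ∈ annihilator (ClosedSubmodule.mapEquiv φ W) ↔
      f.comp (φ : (ℕ → F) →L[F] (ℕ → F)) ∈ annihilator W := by
  simp only [mem_annihilator, ClosedSubmodule.mem_mapEquiv_iff]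
  constructor
  · intro h x hx
    exact h (φ x) (by simpa using hx)
  · intro h x hx
    simpa using h _ hx

theorem card_quotient_annihilator_mapEquiv (φ : (ℕ → F) ≃L[F] (ℕ → F))
    (W : ClosedSubmodule F (ℕ → F)) :
    Nat.card (((ℕ → F) →L[F] F) ⧸ annihilator (ClosedSubmodule.mapEquiv φ W)) =
      Nat.card (((ℕ → F) →L[F] F) ⧸ annihilator W) := by
  let e : ((ℕ → F) →L[F] F) ≃ₗ[F] ((ℕ → F) →L[F] F) :=
    { toFun := fun f => f.comp (φ : (ℕ → F) →L[F] (ℕ → F))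
      invFun := fun f => f.comp (φ.symm : (ℕ → F) →L[F] (ℕ → F))
      map_add' := fun _ _ => rfl
      map_smul' := fun _ _ => rfl
      left_inv := fun f => by ext x; simp
      right_inv := fun f => by ext x; simp }
  refine Nat.card_congr (Submodule.Quotient.equiv _ _ e ?_).toEquiv
  rw [Submodule.map_equiv_eq_comap_symm]
  ext f
  rw [Submodule.mem_comap]
  refine (annihilator_mapEquiv_mem φ W _).trans (iff_of_eq ?_)
  congr 1
  exact e.apply_symm_apply f

end Dual

/-! ### The Borel structure in terms of annihilators -/

section Borel

variable {F : Type*} [Field F] [TopologicalSpace F] [DiscreteTopology F]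

theorem isOpen_setOf_mem_annihilator [Finite F] (f : (ℕ → F) →L[F] F) :
    IsOpen {W : ClosedSubmodule F (ℕ → F) | f ∈ annihilator W} := by
  refine isOpen_generateFrom_of_mem (Or.inl ⟨f ⁻¹' {0}ᶜ, ?_, ?_⟩)
  · exact ((isClosed_discrete _).preimage f.continuous).isCompact
  · ext W
    simp only [Set.mem_ofPred_eq, mem_annihilator, Set.disjoint_left]
    exact ⟨fun h x hx hfx => hfx (h x hx), fun h x hx => not_not.1 (h hx)⟩

theorem measurableSet_mem_annihilator [Finite F] (f : (ℕ → F) →L[F] F) :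
    MeasurableSet {W : ClosedSubmodule F (ℕ → F) | f ∈ annihilator W} :=
  (isOpen_setOf_mem_annihilator f).measurableSet

instance countable_dual_pi [Finite F] : Countable ((ℕ → F) →L[F] F) := by
  have : (⋃ n, (coordSpan F n : Set ((ℕ → F) →L[F] F))) = Set.univ :=
    Set.eq_univ_of_forall fun f => Set.mem_iUnion.2 (exists_mem_coordSpan f)
  rw [← Set.countable_univ_iff, ← this]
  exact Set.countable_iUnion fun n => (finite_coordSpan n).countable

variable (F) in
/-- The sets of closed subspaces annihilated (or not annihilated) by a given functional. -/
def annihilatorSubbasis : Set (Set (ClosedSubmodule F (ℕ → F))) :=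
  (Set.range fun f : (ℕ → F) →L[F] F => {W | f ∈ annihilator W}) ∪
    Set.range fun f : (ℕ → F) →L[F] F => {W | f ∈ annihilator W}ᶜ

theorem generateFrom_annihilatorSubbasis_le_chabauty [Finite F] :
    generateFrom (annihilatorSubbasis F) ≤ ClosedSubmodule.chabauty := by
  let τ : TopologicalSpace (ClosedSubmodule F (ℕ → F)) := generateFrom (annihilatorSubbasis F)
  have hmem : ∀ f : (ℕ → F) →L[F] F, IsOpen[τ] {W | f ∈ annihilator W} := fun f =>
    isOpen_generateFrom_of_mem (Or.inl ⟨f, rfl⟩)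
  have hnot : ∀ f : (ℕ → F) →L[F] F, IsOpen[τ] {W | f ∈ annihilator W}ᶜ := fun f =>
    isOpen_generateFrom_of_mem (Or.inr ⟨f, rfl⟩)
  refine le_generateFrom ?_
  rintro _ (⟨K, hK, rfl⟩ | ⟨U, hU, rfl⟩)
  · refine isOpen_iff_forall_mem_open.2 fun W (hW : Disjoint (W : Set (ℕ → F)) K) => ?_
    -- The zero sets of the functionals in `annihilator W` intersect in `W`, which misses `K`; by
    -- compactness finitely many of them already do.
    obtain ⟨u, hu⟩ := hK.elim_finite_subfamily_closed
      (fun f : annihilator W => (f : (ℕ → F) →L[F] F) ⁻¹' {0})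
      (fun f => (isClosed_discrete _).preimage (f : (ℕ → F) →L[F] F).continuous) (by
        rw [Set.eq_empty_iff_forall_notMem]
        rintro x ⟨hxK, hx⟩
        obtain ⟨f, hf, hfx⟩ := exists_mem_annihilator_of_notMem
          (W := W) (x := x) fun h => hW.le_bot ⟨h, hxK⟩
        exact hfx (Set.mem_iInter.1 hx ⟨f, hf⟩))
    refine ⟨⋂ f ∈ u, {W' | (f : (ℕ → F) →L[F] F) ∈ annihilator W'}, ?_,
      isOpen_biInter_finset fun f _ => hmem f, ?_⟩
    · intro W' hW'
      refine Set.disjoint_left.2 fun x hx hxK => ?_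
      refine Set.eq_empty_iff_forall_notMem.1 hu x ⟨hxK, ?_⟩
      simp only [Set.mem_iInter] at hW' ⊢
      exact fun f hf => hW' f hf x hx
    · simp only [Set.mem_iInter]
      exact fun f _ => f.2
  · refine isOpen_iff_forall_mem_open.2 ?_
    rintro W ⟨x, hxW, hxU⟩
    obtain ⟨n, hn⟩ := exists_cylinder_subset hU hxU
    refine ⟨⋂ f ∈ {f | f ∈ coordSpan F n ∧ f ∉ annihilator W}, {W' | f ∈ annihilator W'}ᶜ, ?_,
      Set.Finite.isOpen_biInter ?_ fun f _ => hnot f, ?_⟩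
    · intro W' hW'
      simp only [Set.mem_iInter] at hW'
      by_contra hne
      obtain ⟨f, hfn, hf, hfx⟩ := exists_mem_annihilator_apply_ne_zero (W := W') (x := x) (n := n)
        (by
          intro y hy
          by_contra! h
          exact hne ⟨y, hy, hn y h⟩)
      exact hW' f ⟨hfn, fun h => hfx (h x hxW)⟩ hf
    · exact (finite_coordSpan n).subset fun f hf => hf.1
    · simp only [Set.mem_iInter]
      exact fun f hf => hf.2

theorem borel_le_generateFrom_annihilator [Finite F] :
    ClosedSubmodule.borelMeasurableSpace ≤ MeasurableSpace.generateFrom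
      (Set.range fun f : (ℕ → F) →L[F] F => {W | f ∈ annihilator W}) := by
  let τ : TopologicalSpace (ClosedSubmodule F (ℕ → F)) := generateFrom (annihilatorSubbasis F)
  -- Countability of the dual gives second countability, so the subbasis generates the Borel sets.
  have hsc : @SecondCountableTopology _ τ :=
    @SecondCountableTopology.mk _ τ
      ⟨annihilatorSubbasis F, (Set.countable_range _).union (Set.countable_range _), rfl⟩
  refine (borel_anti generateFrom_annihilatorSubbasis_le_chabauty).trans ?_
  rw [@borel_eq_generateFrom_of_subbasis _ (annihilatorSubbasis F) τ hsc rfl]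
  refine MeasurableSpace.generateFrom_le ?_
  rintro _ (⟨f, rfl⟩ | ⟨f, rfl⟩)
  · exact MeasurableSpace.measurableSet_generateFrom ⟨f, rfl⟩
  · exact @MeasurableSet.compl _ _ (_) (MeasurableSpace.measurableSet_generateFrom ⟨f, rfl⟩)

/-- A law of a random closed subspace of `F^ℕ` is determined by the probabilities that it is
annihilated by given linearly independent functionals. -/
theorem measure_ext_of_annihilator [Finite F] {μ ν : Measure (ClosedSubmodule F (ℕ → F))}
    [IsProbabilityMeasure μ] [IsProbabilityMeasure ν]
    (h : ∀ (m : ℕ) (f : Fin m → ((ℕ → F) →L[F] F)), LinearIndependent F f →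
      μ {W | ∀ i, f i ∈ annihilator W} = ν {W | ∀ i, f i ∈ annihilator W}) : μ = ν := by
  let C : Set (Set (ClosedSubmodule F (ℕ → F))) :=
    Set.range fun s : Finset ((ℕ → F) →L[F] F) => {W | ∀ f ∈ s, f ∈ annihilator W}
  refine ext_of_generate_finite C ?_ ?_ ?_ (by simp)
  · refine le_antisymm (borel_le_generateFrom_annihilator.trans ?_) ?_
    · refine MeasurableSpace.generateFrom_mono ?_
      rintro _ ⟨f, rfl⟩
      exact ⟨{f}, by simp⟩
    · refine MeasurableSpace.generateFrom_le ?_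
      rintro _ ⟨s, rfl⟩
      simp only [Set.ofPred_forall]
      exact Finset.measurableSet_biInter s fun f _ => measurableSet_mem_annihilator f
  · classical
    rintro _ ⟨s, rfl⟩ _ ⟨t, rfl⟩ -
    refine ⟨s ∪ t, ?_⟩
    ext W
    simp only [Set.mem_ofPred_eq, Set.mem_inter_iff, Finset.mem_union, or_imp, forall_and]
  · rintro _ ⟨s, rfl⟩
    -- Being annihilated by `s` depends only on its span, so `s` may be replaced by a basis of it.
    obtain ⟨m, b, hb, hspan⟩ := exists_linearIndependent_span_eq (K := F) s
    have hset : {W : ClosedSubmodule F (ℕ → F) | ∀ f ∈ s, f ∈ annihilator W} =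
        {W | ∀ i, b i ∈ annihilator W} := by
      ext W
      have h1 : (∀ f ∈ s, f ∈ annihilator W) ↔
          Submodule.span F (s : Set ((ℕ → F) →L[F] F)) ≤ annihilator W := Submodule.span_le.symm
      have h2 : (∀ i, b i ∈ annihilator W) ↔
          Submodule.span F (Set.range fun i => b i) ≤ annihilator W := by
        rw [Submodule.span_le, Set.range_subset_iff]; rfl
      rw [Set.mem_ofPred_eq, Set.mem_ofPred_eq, h1, h2, hspan]
    change μ {W | ∀ f ∈ s, f ∈ annihilator W} = ν {W | ∀ f ∈ s, f ∈ annihilator W}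
    rw [hset]
    exact h m b hb

end Borel

/-! ### Density of the annihilator and its index -/

section Density

/-- The proportion of a submodule in an exhausting sequence of finite submodules tends to the
inverse of its index (`0` if the index is infinite). -/
theorem tendsto_card_inf_div_card {R M : Type*} [Ring R] [AddCommGroup M] [Module R M]
    (A : Submodule R M) {U : ℕ → Submodule R M} (hmono : Monotone U) (hfin : ∀ n, Finite (U n))
    (hU : ∀ x, ∃ n, x ∈ U n) :
    Tendsto (fun n => (Nat.card (A ⊓ U n : Submodule R M) : ℝ) / Nat.card (U n)) atTop
      (𝓝 (Nat.card (M ⧸ A) : ℝ)⁻¹) := by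
  -- First isomorphism theorem for `U n → M ⧸ A`: the proportion is the inverse of the size of the
  -- image, and these images exhaust the quotient.
  have hcard : ∀ n, Nat.card (U n) =
      Nat.card (A ⊓ U n : Submodule R M) * Nat.card ((U n).map A.mkQ) := by
    intro n
    have h1 := Submodule.card_eq_card_quotient_mul_card (LinearMap.ker (A.mkQ.domRestrict (U n)))
    rw [Nat.card_congr (LinearMap.quotKerEquivRange (A.mkQ.domRestrict (U n))).toEquiv,
      LinearMap.range_domRestrict] at h1
    rw [h1]
    congr 1
    refine Nat.card_congr
      { toFun := fun x => ⟨x.1.1, ⟨?_, x.1.2⟩⟩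
        invFun := fun x => ⟨⟨x.1, x.2.2⟩, ?_⟩
        left_inv := fun _ => rfl
        right_inv := fun _ => rfl }
    · exact (Submodule.Quotient.mk_eq_zero A).1 x.2
    · exact (Submodule.Quotient.mk_eq_zero A).2 x.2.1
  have hfinmap : ∀ n, Finite ((U n).map A.mkQ) := fun n =>
    (Set.Finite.image A.mkQ (Set.toFinite (U n : Set M))).to_subtype
  have hfininf : ∀ n, Finite (A ⊓ U n : Submodule R M) := fun n =>
    ((Set.toFinite (U n : Set M)).subset (fun x hx => hx.2)).to_subtype
  have heq : ∀ n, (Nat.card (A ⊓ U n : Submodule R M) : ℝ) / Nat.card (U n) =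
      (Nat.card ((U n).map A.mkQ) : ℝ)⁻¹ := by
    intro n
    have h0 : (Nat.card (A ⊓ U n : Submodule R M) : ℝ) ≠ 0 := Nat.cast_ne_zero.2 Nat.card_pos.ne'
    rw [hcard n, Nat.cast_mul]
    field_simp
  simp only [heq]
  have hex : ∀ t : Finset (M ⧸ A), ∃ N, ∀ n ≥ N, (t : Set (M ⧸ A)) ⊆ (U n).map A.mkQ := by
    intro t
    have hx : ∀ y : M ⧸ A, ∃ n, y ∈ (U n).map A.mkQ := by
      intro y
      obtain ⟨x, rfl⟩ := A.mkQ_surjective y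
      obtain ⟨n, hn⟩ := hU x
      exact ⟨n, x, hn, rfl⟩
    choose N hN using hx
    exact ⟨t.sup N, fun n hn y hy =>
      Submodule.map_mono (hmono ((Finset.le_sup hy).trans hn)) (hN y)⟩
  cases finite_or_infinite (M ⧸ A) with
  | inl hfinite =>
    have := Fintype.ofFinite (M ⧸ A)
    obtain ⟨N, hN⟩ := hex Finset.univ
    refine tendsto_const_nhds.congr' ?_
    filter_upwards [eventually_ge_atTop N] with n hn
    have htop : (U n).map A.mkQ = ⊤ :=
      Submodule.eq_top_iff'.2 fun x => hN n hn (Finset.mem_coe.2 (Finset.mem_univ x))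
    rw [htop, Nat.card_congr Submodule.topEquiv.toEquiv]
  | inr hinf =>
    rw [Nat.card_eq_zero_of_infinite, Nat.cast_zero, inv_zero]
    refine (tendsto_natCast_atTop_atTop.comp (tendsto_atTop.2 fun b => ?_)).inv_tendsto_atTop
    obtain ⟨t, ht⟩ := Infinite.exists_subset_card_eq (M ⧸ A) b
    obtain ⟨N, hN⟩ := hex t
    filter_upwards [eventually_ge_atTop N] with n hn
    rw [← ht, ← Set.ncard_coe_finset]
    exact Set.ncard_le_ncard (hN n hn) (Set.toFinite _)

variable {F : Type*} [Field F] [TopologicalSpace F] [DiscreteTopology F]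

/-- The proportion of the first `|F|^n` functionals that vanish on a closed subspace. -/
noncomputable def annihilatorDensity (n : ℕ) (W : ClosedSubmodule F (ℕ → F)) : ℝ :=
  (Nat.card (annihilator W ⊓ coordSpan F n : Submodule F ((ℕ → F) →L[F] F)) : ℝ) /
    Nat.card (coordSpan F n)

theorem annihilatorDensity_eq_sum (n : ℕ) [Fintype (coordSpan F n)]
    (W : ClosedSubmodule F (ℕ → F)) :
    annihilatorDensity n W = (∑ g : coordSpan F n,
      {W | (g : (ℕ → F) →L[F] F) ∈ annihilator W}.indicator (1 : ClosedSubmodule F (ℕ → F) → ℝ) W) /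
        Nat.card (coordSpan F n) := by
  classical
  unfold annihilatorDensity
  congr 1
  simp only [Set.indicator_apply, Set.mem_ofPred_eq, Pi.one_apply]
  rw [Finset.sum_boole, ← Fintype.card_subtype, ← Nat.card_eq_fintype_card]
  congr 1
  exact Nat.card_congr
    { toFun := fun x => ⟨⟨x.1, x.2.2⟩, x.2.1⟩
      invFun := fun x => ⟨x.1.1, x.2, x.1.2⟩
      left_inv := fun _ => rfl
      right_inv := fun _ => rfl }

variable [Finite F]

theorem tendsto_annihilatorDensity (W : ClosedSubmodule F (ℕ → F)) :
    Tendsto (fun n => annihilatorDensity n W) atTop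
      (𝓝 (Nat.card (((ℕ → F) →L[F] F) ⧸ annihilator W) : ℝ)⁻¹) :=
  tendsto_card_inf_div_card _ coordSpan_mono inferInstance exists_mem_coordSpan

theorem measurable_annihilatorDensity (n : ℕ) :
    Measurable (annihilatorDensity n : ClosedSubmodule F (ℕ → F) → ℝ) := by
  have := Fintype.ofFinite (coordSpan F n)
  rw [funext (annihilatorDensity_eq_sum (F := F) n)]
  exact (Finset.measurable_sum _ fun g _ =>
    measurable_one.indicator (measurableSet_mem_annihilator _)).div_const _

theorem annihilatorDensity_mem_Icc (n : ℕ) (W : ClosedSubmodule F (ℕ → F)) :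
    annihilatorDensity n W ∈ Set.Icc (0 : ℝ) 1 := by
  refine ⟨by unfold annihilatorDensity; positivity, div_le_one_of_le₀ ?_ (by positivity)⟩
  exact Nat.cast_le.2 (Nat.card_le_card_of_injective _ (Submodule.inclusion_injective inf_le_right))

/-- The inverse index is a pointwise limit of measurable densities. With `0⁻¹ = 0` inversion is
injective, so `k = 0`, the infinite index, is covered too. -/
theorem measurableSet_card_quotient_annihilator_eq (k : ℕ) :
    MeasurableSet {W : ClosedSubmodule F (ℕ → F) |
      Nat.card (((ℕ → F) →L[F] F) ⧸ annihilator W) = k} := by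
  have hm : Measurable fun W : ClosedSubmodule F (ℕ → F) =>
      (Nat.card (((ℕ → F) →L[F] F) ⧸ annihilator W) : ℝ)⁻¹ :=
    measurable_of_tendsto_metrizable measurable_annihilatorDensity
      (tendsto_pi_nhds.2 tendsto_annihilatorDensity)
  convert hm (measurableSet_singleton ((k : ℝ)⁻¹)) using 1
  ext W
  simp

end Density

/-! ### Consequences of invariance and indecomposability -/

section Invariant

/-- Otherwise `lam` would be a proper mixture of its conditionings on `E` and `Eᶜ`, which are again
invariant, and are distinct because they disagree on `E`. -/
theorem indecomposableCRS.measure_eq_zero_or_compl {F : Type*} [Field F] [TopologicalSpace F]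
    {lam : Measure (ClosedSubmodule F (ℕ → F))}
    (hlam : lam ∈ indecomposableCRS F (ℕ → F)) {E : Set (ClosedSubmodule F (ℕ → F))}
    (hE : MeasurableSet E)
    (hinv : ∀ φ : (ℕ → F) ≃L[F] (ℕ → F), ClosedSubmodule.mapEquiv φ ⁻¹' E = E) :
    lam E = 0 ∨ lam Eᶜ = 0 := by
  have := hlam.1.1
  by_contra! h
  have key : ∀ A : Set (ClosedSubmodule F (ℕ → F)), MeasurableSet A → lam A ≠ 0 →
      (∀ φ : (ℕ → F) ≃L[F] (ℕ → F), ClosedSubmodule.mapEquiv φ ⁻¹' A = A) →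
        ProbabilityTheory.cond lam A ∈ CRS F (ℕ → F) := by
    intro A hA h0 hA'
    refine ⟨ProbabilityTheory.cond_isProbabilityMeasure h0, fun φ => ?_⟩
    rw [ProbabilityTheory.cond, Measure.map_smul]
    conv_lhs => rw [← hA' φ]
    rw [← Measure.restrict_map (ClosedSubmodule.measurable_mapEquiv φ) hA, hlam.1.2 φ, hA' φ]
  have hsum : lam E + lam Eᶜ = 1 := by rw [measure_add_measure_compl hE, measure_univ]
  have hcoe : ((lam E).toNNReal : ENNReal) = lam E := ENNReal.coe_toNNReal (measure_ne_top _ _)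
  have hcoe' : ((1 - (lam E).toNNReal : ℝ≥0) : ENNReal) = lam Eᶜ := by
    rw [ENNReal.coe_sub, hcoe, ENNReal.coe_one, prob_compl_eq_one_sub hE]
  have hlt : lam E < 1 := by
    rw [← hsum]
    exact ENNReal.lt_add_right (measure_ne_top _ _) h.2
  refine hlam.2 ⟨_, key E hE h.1 hinv, _, key Eᶜ hE.compl h.2 (fun φ => by
    rw [Set.preimage_compl, hinv]), (lam E).toNNReal, ?_, ?_, ?_, ?_⟩
  · intro heq
    have h' := congrArg (fun μ : Measure (ClosedSubmodule F (ℕ → F)) => μ E) heq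
    simp only [ProbabilityTheory.cond_apply hE, ProbabilityTheory.cond_apply hE.compl,
      Set.inter_self, Set.compl_inter_self, measure_empty, mul_zero] at h'
    rw [ENNReal.inv_mul_cancel h.1 (measure_ne_top _ _)] at h'
    exact one_ne_zero h'
  · exact ENNReal.toNNReal_pos h.1 (measure_ne_top _ _)
  · rw [← ENNReal.coe_lt_coe, hcoe]; simpa using hlt
  · ext A hA
    rw [Measure.add_apply, Measure.smul_apply, Measure.smul_apply, ENNReal.smul_def,
      ENNReal.smul_def, hcoe, hcoe', ProbabilityTheory.cond_apply hE,
      ProbabilityTheory.cond_apply hE.compl, smul_eq_mul, smul_eq_mul, ← mul_assoc, ← mul_assoc,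
      ENNReal.mul_inv_cancel h.1 (measure_ne_top _ _),
      ENNReal.mul_inv_cancel h.2 (measure_ne_top _ _), one_mul, one_mul, Set.inter_comm,
      Set.inter_comm Eᶜ, ← Set.sdiff_eq, measure_inter_add_sdiff A hE]

variable {F : Type*} [Field F] [TopologicalSpace F] [DiscreteTopology F]

theorem exists_continuousLinearEquiv_transvection (d : (ℕ → F) →L[F] F) (v : ℕ → F) (hv : d v = 0) :
    ∃ φ : (ℕ → F) ≃L[F] (ℕ → F), ∀ x, φ x = x + d x • v :=
  ⟨ContinuousLinearEquiv.equivOfInverse (.id F _ + d.smulRight v) (.id F _ - d.smulRight v)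
    (fun x => by simp [hv]) (fun x => by simp [hv]), fun x => by simp⟩

variable [Finite F]

theorem measurableSet_forall_mem_annihilator (s : Set ((ℕ → F) →L[F] F)) :
    MeasurableSet {W : ClosedSubmodule F (ℕ → F) | ∀ f ∈ s, f ∈ annihilator W} := by
  simp only [Set.ofPred_forall]
  exact MeasurableSet.biInter s.to_countable fun f _ => measurableSet_mem_annihilator f

/-- Some automorphism of `F^ℕ` pulls `f` back to `g` and fixes every element of `s`: the
transvection along `g - f` with a vector `v` such that `f v = g v = 1` and `s` vanishes at `v`. -/
theorem CRS.measure_inter_mem_annihilator_eq {lam : Measure (ClosedSubmodule F (ℕ → F))}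
    (hlam : lam ∈ CRS F (ℕ → F)) {s : Set ((ℕ → F) →L[F] F)} {f g : (ℕ → F) →L[F] F}
    (hf : f ∉ Submodule.span F s) (hg : g ∉ Submodule.span F (insert f s)) :
    lam ({W | f ∈ annihilator W} ∩ {W | ∀ f ∈ s, f ∈ annihilator W}) =
      lam ({W | g ∈ annihilator W} ∩ {W | ∀ f ∈ s, f ∈ annihilator W}) := by
  obtain ⟨l₀, hl₀, hs₀⟩ := Submodule.exists_le_ker_of_notMem hf
  obtain ⟨l₁, hl₁, hs₁⟩ := Submodule.exists_le_ker_of_notMem hg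
  have hf₁ : l₁ f = 0 := hs₁ (Submodule.subset_span (Set.mem_insert _ _))
  have h₁ : ∀ x ∈ s, l₁ x = 0 := fun x hx =>
    hs₁ (Submodule.subset_span (Set.mem_insert_of_mem _ hx))
  have h₀ : ∀ x ∈ s, l₀ x = 0 := fun x hx => hs₀ (Submodule.subset_span hx)
  -- The first term gives `f` the value `1`; the second does not affect `f` and corrects the value
  -- at `g` to `1`. Both vanish on `s`.
  obtain ⟨v, hv⟩ := exists_forall_apply_eq
    ((l₀ f)⁻¹ • l₀ + ((1 - (l₀ f)⁻¹ * l₀ g) * (l₁ g)⁻¹) • l₁)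
  have hvf : f v = 1 := by rw [hv]; simp [hf₁, hl₀]
  have hvg : g v = 1 := by rw [hv]; simp [hl₁]
  have hvs : ∀ x ∈ s, x v = 0 := fun x hx => by rw [hv]; simp [h₀ x hx, h₁ x hx]
  obtain ⟨φ, hφ⟩ := exists_continuousLinearEquiv_transvection (g - f) v (by simp [hvf, hvg])
  have hfφ : f.comp (φ : (ℕ → F) →L[F] (ℕ → F)) = g := by
    ext x; simp [hφ, hvf]
  have hsφ : ∀ x ∈ s, x.comp (φ : (ℕ → F) →L[F] (ℕ → F)) = x := by
    intro y hy; ext x; simp [hφ, hvs y hy]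
  conv_lhs => rw [← hlam.2 φ]
  rw [Measure.map_apply (ClosedSubmodule.measurable_mapEquiv φ)
    ((measurableSet_mem_annihilator f).inter (measurableSet_forall_mem_annihilator s))]
  congr 1
  ext W
  simp only [Set.mem_preimage, Set.mem_inter_iff, Set.mem_ofPred_eq, annihilator_mapEquiv_mem, hfφ]
  refine and_congr_right fun _ => forall₂_congr fun x hx => ?_
  rw [hsφ x hx]

theorem integral_annihilatorDensity {μ : Measure (ClosedSubmodule F (ℕ → F))}
    [IsFiniteMeasure μ] (n : ℕ) [Fintype (coordSpan F n)] :
    ∫ W, annihilatorDensity n W ∂μ =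
      (∑ g : coordSpan F n, μ.real {W | (g : (ℕ → F) →L[F] F) ∈ annihilator W}) /
        Nat.card (coordSpan F n) := by
  simp only [annihilatorDensity_eq_sum, integral_div]
  rw [integral_finsetSum]
  · simp only [integral_indicator_one (measurableSet_mem_annihilator _)]
  · intro g _
    exact (integrable_const (μ := μ) (1 : ℝ)).indicator (measurableSet_mem_annihilator _)

/-- An invariant random closed subspace whose annihilator almost surely has index `k` (`0` if
infinite) is annihilated by `m` given independent functionals with probability `k⁻¹ ^ m`. -/
theorem CRS.measureReal_forall_mem_annihilator {lam : Measure (ClosedSubmodule F (ℕ → F))}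
    (hlam : lam ∈ CRS F (ℕ → F)) {k : ℕ}
    (hk : ∀ᵐ W ∂lam, Nat.card (((ℕ → F) →L[F] F) ⧸ annihilator W) = k) (m : ℕ)
    (f : Fin m → ((ℕ → F) →L[F] F)) (hf : LinearIndependent F f) :
    lam.real {W | ∀ i, f i ∈ annihilator W} = (k : ℝ)⁻¹ ^ m := by
  have := hlam.1
  induction m with
  | zero => simp
  | succ m ih =>
    obtain ⟨x, f, rfl⟩ : ∃ x f', f = Fin.cons x f' := ⟨f 0, Fin.tail f, (Fin.cons_self_tail f).symm⟩
    obtain ⟨hf, hx⟩ := linearIndependent_finCons.1 hf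
    set s := Set.range f with hs
    set E : Set (ClosedSubmodule F (ℕ → F)) := {W | ∀ g ∈ s, g ∈ annihilator W} with hE
    have hEm : MeasurableSet E := measurableSet_forall_mem_annihilator s
    have hEf : lam.real E = (k : ℝ)⁻¹ ^ m := by
      rw [← ih f hf]
      simp [hE, hs]
    have hxE : {W : ClosedSubmodule F (ℕ → F) |
        ∀ i, (Fin.cons x f : Fin (m + 1) → ((ℕ → F) →L[F] F)) i ∈ annihilator W} =
          {W | x ∈ annihilator W} ∩ E := by
      ext W
      simp [hE, hs, Fin.forall_fin_succ]
    rw [hxE]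
    set p := lam.real ({W | x ∈ annihilator W} ∩ E) with hp
    set T := Submodule.span F (insert x s)
    have hT : (T : Set ((ℕ → F) →L[F] F)).Finite := by
      have : FiniteDimensional F T :=
        FiniteDimensional.span_of_finite F ((Set.finite_range f).insert x)
      have : Finite T := Module.finite_of_finite F
      exact Set.toFinite _
    -- The same integrals have two limits: here by dominated convergence from the almost sure index
    -- `k`, then in `h2` by exchangeability of the functionals outside `T`.
    have h1 : Tendsto (fun n => ∫ W, annihilatorDensity n W ∂(lam.restrict E)) atTop
        (𝓝 ((k : ℝ)⁻¹ ^ (m + 1))) := by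
      have hlim : ∫ _, (k : ℝ)⁻¹ ∂(lam.restrict E) = (k : ℝ)⁻¹ ^ (m + 1) := by
        rw [integral_const, smul_eq_mul, measureReal_restrict_apply_univ, hEf, pow_succ]
      rw [← hlim]
      refine tendsto_integral_of_dominated_convergence (fun _ => 1)
        (fun n => (measurable_annihilatorDensity n).aestronglyMeasurable) (integrable_const _)
        (fun n => Eventually.of_forall fun W => ?_) ?_
      · have := annihilatorDensity_mem_Icc n W
        rw [Real.norm_eq_abs, abs_of_nonneg this.1]
        exact this.2
      · filter_upwards [ae_restrict_of_ae hk] with W hW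
        rw [← hW]
        exact tendsto_annihilatorDensity W
    have h2 : Tendsto (fun n => ∫ W, annihilatorDensity n W ∂(lam.restrict E)) atTop (𝓝 p) := by
      have hbound : ∀ n, |∫ W, annihilatorDensity n W ∂(lam.restrict E) - p| ≤
          (Nat.card T : ℝ) / (Nat.card F : ℝ) ^ n := by
        intro n
        have := Fintype.ofFinite (coordSpan F n)
        classical
        have hpos : (0 : ℝ) < (Nat.card F : ℝ) ^ n := by
          have : 0 < Nat.card F := Nat.card_pos
          positivity
        rw [integral_annihilatorDensity, card_coordSpan, Nat.cast_pow]
        have hsum : ∑ _g : coordSpan F n, p = (Nat.card F : ℝ) ^ n * p := by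
          rw [Finset.sum_const, Finset.card_univ, ← Nat.card_eq_fintype_card, card_coordSpan]
          simp
        have : (∑ g : coordSpan F n, (lam.restrict E).real {W | (g : (ℕ → F) →L[F] F) ∈ annihilator W}) /
            (Nat.card F : ℝ) ^ n - p = (∑ g : coordSpan F n,
              ((lam.restrict E).real {W | (g : (ℕ → F) →L[F] F) ∈ annihilator W} - p)) /
                (Nat.card F : ℝ) ^ n := by
          rw [Finset.sum_sub_distrib, hsum]
          field_simp
        rw [this, abs_div, abs_of_pos hpos]
        gcongr
        -- Terms with `g` outside `T` vanish exactly; the others number at most `|T|`, independently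
        -- of `n`, and are negligible against `|F|^n`.
        have hterm : ∀ g : coordSpan F n,
            |(lam.restrict E).real {W | (g : (ℕ → F) →L[F] F) ∈ annihilator W} - p| ≤
              if (g : (ℕ → F) →L[F] F) ∈ T then 1 else 0 := by
          intro g
          rw [measureReal_restrict_apply (measurableSet_mem_annihilator _)]
          split_ifs with hg
          · rw [abs_le]
            have h01 : ∀ A, 0 ≤ lam.real A ∧ lam.real A ≤ 1 := fun A =>
              ⟨measureReal_nonneg, measureReal_le_one⟩
            have hg01 := h01 ({W | (g : (ℕ → F) →L[F] F) ∈ annihilator W} ∩ E)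
            have hp01 := h01 ({W | x ∈ annihilator W} ∩ E)
            constructor <;> linarith
          · rw [hp, measureReal_def, measureReal_def,
              CRS.measure_inter_mem_annihilator_eq hlam hx hg, sub_self, abs_zero]
        refine (Finset.abs_sum_le_sum_abs _ _).trans
          ((Finset.sum_le_sum fun g _ => hterm g).trans ?_)
        rw [Finset.sum_boole, ← Fintype.card_subtype, ← Nat.card_eq_fintype_card, Nat.cast_le]
        have : Finite T := hT.to_subtype
        exact Nat.card_le_card_of_injective
          (fun g : {g : coordSpan F n // (g : (ℕ → F) →L[F] F) ∈ T} => (⟨g.1, g.2⟩ : T))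
          fun a b hab => Subtype.ext (Subtype.ext (Subtype.mk.inj hab))
      refine tendsto_iff_norm_sub_tendsto_zero.2 (squeeze_zero (fun _ => norm_nonneg _) hbound ?_)
      refine tendsto_const_nhds.div_atTop (tendsto_pow_atTop_atTop_of_one_lt ?_)
      exact_mod_cast Finite.one_lt_card (α := F)
    exact tendsto_nhds_unique h2 h1

/-- The index takes countably many values, each on an invariant event; were none almost sure, all
these events would be null, yet they cover the space. -/
theorem indecomposableCRS.exists_ae_card_eq {lam : Measure (ClosedSubmodule F (ℕ → F))}
    (hlam : lam ∈ indecomposableCRS F (ℕ → F)) :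
    ∃ k : ℕ, ∀ᵐ W ∂lam, Nat.card (((ℕ → F) →L[F] F) ⧸ annihilator W) = k := by
  have := hlam.1.1
  by_contra h
  rw [not_exists] at h
  have h0 : ∀ k : ℕ, lam {W | Nat.card (((ℕ → F) →L[F] F) ⧸ annihilator W) = k} = 0 := fun k =>
    (indecomposableCRS.measure_eq_zero_or_compl hlam (measurableSet_card_quotient_annihilator_eq k) fun φ => by
      ext W; simp [card_quotient_annihilator_mapEquiv]).resolve_right (h k)
  have h1 := measure_iUnion_null h0
  have : (⋃ k, {W : ClosedSubmodule F (ℕ → F) |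
      Nat.card (((ℕ → F) →L[F] F) ⧸ annihilator W) = k}) = Set.univ := by
    ext W; simp
  rw [this, measure_univ] at h1
  exact one_ne_zero h1

end Invariant

/-! ### The Haar and Dirac laws -/

section Law

variable {F : Type*} [Field F] [TopologicalSpace F] [DiscreteTopology F]

theorem exists_forall_apply_eq_of_linearIndependent {m : ℕ} {f : Fin m → ((ℕ → F) →L[F] F)}
    (hf : LinearIndependent F f) (c : Fin m → F) : ∃ v, ∀ i, f i v = c i := by
  obtain ⟨l, hl⟩ := LinearMap.exists_extend ((Module.Basis.span hf).constr F c)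
  obtain ⟨v, hv⟩ := exists_forall_apply_eq l
  refine ⟨v, fun i => ?_⟩
  rw [hv]
  have h := LinearMap.congr_fun hl (Module.Basis.span hf i)
  rw [Module.Basis.constr_basis] at h
  rw [← h, LinearMap.comp_apply, Submodule.subtype_apply, Module.Basis.span_apply]

instance isProbabilityMeasure_haarProb {G : Type*} [AddGroup G] [TopologicalSpace G]
    [IsTopologicalAddGroup G] [CompactSpace G] [MeasurableSpace G] [BorelSpace G] :
    IsProbabilityMeasure (haarProb G) :=
  ⟨by simpa [haarProb] using Measure.addHaarMeasure_self (K₀ := (⊤ : PositiveCompacts G))⟩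

instance isAddLeftInvariant_haarProb {G : Type*} [AddGroup G] [TopologicalSpace G]
    [IsTopologicalAddGroup G] [CompactSpace G] [MeasurableSpace G] [BorelSpace G] :
    (haarProb G).IsAddLeftInvariant := by
  unfold haarProb
  infer_instance

variable [Finite F]

/-- The event is the kernel of a surjective homomorphism from the compact group onto the `m × κ`
matrices over `F`, so its Haar measure is the inverse of the index. -/
theorem haarProb_map_imageSubspace (κ m : ℕ) (f : Fin m → ((ℕ → F) →L[F] F))
    (hf : LinearIndependent F f) :
    ((haarProb ((Fin κ → F) →L[F] (ℕ → F))).map imageSubspace).real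
      {W | ∀ i, f i ∈ annihilator W} = (((Nat.card F ^ κ : ℕ) : ℝ)⁻¹) ^ m := by
  have hm : MeasurableSet {W : ClosedSubmodule F (ℕ → F) | ∀ i, f i ∈ annihilator W} := by
    simp only [Set.ofPred_forall]
    exact MeasurableSet.iInter fun i => measurableSet_mem_annihilator _
  rw [measureReal_def, Measure.map_apply measurable_imageSubspace hm]
  let Φ : ((Fin κ → F) →L[F] (ℕ → F)) →+ (Fin m → Fin κ → F) :=
    { toFun := fun h i j => f i (h (Pi.single j 1))
      map_zero' := by ext i j; simp
      map_add' := fun h h' => by ext i j; simp }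
  have hset : imageSubspace ⁻¹' {W : ClosedSubmodule F (ℕ → F) | ∀ i, f i ∈ annihilator W} =
      (Φ.ker : Set ((Fin κ → F) →L[F] (ℕ → F))) := by
    ext h
    simp only [Set.mem_preimage, Set.mem_ofPred_eq, SetLike.mem_coe, AddMonoidHom.mem_ker,
      mem_annihilator]
    constructor
    · intro H
      ext i j
      exact H i _ ⟨_, rfl⟩
    · rintro H i _ ⟨x, rfl⟩
      have : (f i : (ℕ → F) →ₗ[F] F) ∘ₗ (h : (Fin κ → F) →ₗ[F] (ℕ → F)) = 0 := by
        refine LinearMap.pi_ext' fun j => LinearMap.ext_ring ?_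
        exact congr_fun (congr_fun H i) j
      exact LinearMap.congr_fun this x
  have hsurj : Function.Surjective Φ := by
    intro c
    choose v hv using fun j : Fin κ =>
      exists_forall_apply_eq_of_linearIndependent hf fun i => c i j
    refine ⟨⟨Fintype.linearCombination F v, continuous_of_discreteTopology⟩, ?_⟩
    ext i j
    simp [Φ, Fintype.linearCombination_apply_single, hv]
  have hindex : Φ.ker.index = (Nat.card F ^ κ) ^ m := by
    rw [AddSubgroup.index_ker, AddMonoidHom.range_eq_top.2 hsurj]
    simp [Nat.card_fun]
  have hker : MeasurableSet (Φ.ker : Set ((Fin κ → F) →L[F] (ℕ → F))) :=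
    hset ▸ measurable_imageSubspace hm
  have hne : Φ.ker.index ≠ 0 := by
    rw [hindex]; exact pow_ne_zero _ (pow_ne_zero _ Nat.card_pos.ne')
  have : Φ.ker.FiniteIndex := ⟨hne⟩
  have h := AddSubgroup.index_mul_measure Φ.ker hker (haarProb ((Fin κ → F) →L[F] (ℕ → F)))
  rw [measure_univ, hindex] at h
  rw [hset, inv_pow, ← Nat.cast_pow]
  refine eq_inv_of_mul_eq_one_right ?_
  have h' := congrArg ENNReal.toReal h
  simpa using h'

/-- This is the infinite index case `k = 0`: no nonzero functional annihilates the whole space, and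
`0 ^ 0 = 1` accounts for the empty family. -/
theorem dirac_top_measureReal_forall_mem_annihilator (m : ℕ) (f : Fin m → ((ℕ → F) →L[F] F))
    (hf : LinearIndependent F f) :
    (Measure.dirac (⊤ : ClosedSubmodule F (ℕ → F))).real {W | ∀ i, f i ∈ annihilator W} =
      (0 : ℝ) ^ m := by
  cases m with
  | zero => simp
  | succ m =>
    have hm : MeasurableSet {W : ClosedSubmodule F (ℕ → F) | ∀ i, f i ∈ annihilator W} := by
      simp only [Set.ofPred_forall]
      exact MeasurableSet.iInter fun i => measurableSet_mem_annihilator _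
    rw [measureReal_def, Measure.dirac_apply' _ hm, Set.indicator_of_notMem]
    · simp
    · intro h
      exact hf.ne_zero 0 (ContinuousLinearMap.ext fun x => h 0 x trivial)

end Law

theorem mainTheorem6 {F : Type*} [Field F] [Finite F] [TopologicalSpace F] [DiscreteTopology F]
    (lam : MeasureTheory.Measure (ClosedSubmodule F (ℕ → F)))
    (hlam : lam ∈ indecomposableCRS F (ℕ → F))
    (hne : lam ≠ MeasureTheory.Measure.dirac (⊤ : ClosedSubmodule F (ℕ → F))) :
    ∃! κ : ℕ, ProbabilityTheory.HasLaw
      (fun h : (Fin κ → F) →L[F] (ℕ → F) => imageSubspace h) lam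
      (haarProb ((Fin κ → F) →L[F] (ℕ → F))) := by
  have := hlam.1.1
  have hext : ∀ {μ : Measure (ClosedSubmodule F (ℕ → F))} [IsProbabilityMeasure μ] {c : ℝ},
      (∀ (m : ℕ) (f : Fin m → ((ℕ → F) →L[F] F)), LinearIndependent F f →
        μ.real {W | ∀ i, f i ∈ annihilator W} = c ^ m) →
      (∀ (m : ℕ) (f : Fin m → ((ℕ → F) →L[F] F)), LinearIndependent F f →
        lam.real {W | ∀ i, f i ∈ annihilator W} = c ^ m) → μ = lam := by
    intro μ _ c h1 h2
    refine measure_ext_of_annihilator fun m f hf => ?_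
    rw [← ENNReal.toReal_eq_toReal_iff' (measure_ne_top _ _) (measure_ne_top _ _)]
    exact (h1 m f hf).trans (h2 m f hf).symm
  obtain ⟨k, hk⟩ := indecomposableCRS.exists_ae_card_eq hlam
  have hlaw := CRS.measureReal_forall_mem_annihilator hlam.1 hk
  have hprob : ∀ κ : ℕ, IsProbabilityMeasure
      ((haarProb ((Fin κ → F) →L[F] (ℕ → F))).map imageSubspace) := fun κ =>
    Measure.isProbabilityMeasure_map measurable_imageSubspace.aemeasurable
  have hk0 : k ≠ 0 := by
    rintro rfl
    refine hne (hext (c := 0) dirac_top_measureReal_forall_mem_annihilator ?_).symm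
    simpa using hlaw
  obtain ⟨W, hW⟩ := hk.exists
  have : Finite (((ℕ → F) →L[F] F) ⧸ annihilator W) :=
    Nat.finite_of_card_ne_zero (hW ▸ hk0)
  rw [Module.natCard_eq_pow_finrank (K := F)] at hW
  refine ⟨Module.finrank F (((ℕ → F) →L[F] F) ⧸ annihilator W),
    ⟨measurable_imageSubspace.aemeasurable, ?_⟩, fun κ hκ => ?_⟩
  · refine hext (c := (k : ℝ)⁻¹) (fun m f hf => ?_) hlaw
    rw [haarProb_map_imageSubspace _ m f hf, hW]
  -- For uniqueness one functional suffices: the law gives it the probability `|F|^(-κ)` of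
  -- annihilating, which determines `κ`.
  · have hLI : LinearIndependent F
        (fun _ : Fin 1 => (ContinuousLinearMap.proj 0 : (ℕ → F) →L[F] F)) := by
      refine linearIndependent_unique_iff.2 fun h => ?_
      simpa using DFunLike.congr_fun h (1 : ℕ → F)
    have h1 := haarProb_map_imageSubspace κ 1 _ hLI
    have h2 := hlaw 1 _ hLI
    rw [← hκ.map_eq] at h2
    have h3 := h1.symm.trans h2
    rw [pow_one, pow_one, inv_inj, Nat.cast_inj, ← hW] at h3
    exact Nat.pow_right_injective (Finite.one_lt_card (α := F)) h3
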